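/- A planar convex body is a compact convex set $K\subset\mathbb{R}^2$ with nonempty interior that contains the origin $o$. For such $K$ let $V(K)$ be its area and $h_K(\theta)=\max_{x\in K}\langle x,(\cos\theta,\sin\theta)\rangle$ its support function. Call $K$ smooth and strictly convex if it is strictly convex, $h_K$ is of class $C^2$ and $h_K+h_K''>0$ everywhere (equivalently, $\partial K$ is a $C^2$ curve with positive curvature). For planar convex bodies $K,L$ let $r(K,L)=\max\{t>0: x+tL\subseteq K \text{ for some } x\in\mathbb{R}^2\}$ and $R(K,L)=\min\{t>0: x+tL\supseteq K \text{ for some } x\in\mathbb{R}^2\}$. The bodies $K$ and $L$ are at a dilation position if $o\in K\cap L$ and $r(K,L)L\subseteq K\subseteq R(K,L)L$, and they are homothetic if $K=x+cL$ for some $x\in\mathbb{R}^2$ and $c>0$. Let $V(K,L)=\frac12\big(V(K+L)-V(K)-V(L)\big)$ be the mixed area. **Theorem.** Let $K$ and $L$ be smooth, planar strictly convex bodies at a dilation position, let $\rho=(h_K+h_K'')/(h_L+h_L'')$ be the relative curvature radius of $K$ with respect to $L$, and let $F$ be a strictly convex real function on $(0,\infty)$. Then for all $t\ge 0$ the area $V(K+tL)$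 equals the relative Steiner polynomial $V(K)+2V(K,L)t+V(L)t^2$; this polynomial has two real roots $t_1,t_2$ (counted with multiplicity), both negative; the function $F(\rho)\,h_L\,(h_L+h_L'')$ is integrable on $[0,2\pi]$; and $$\frac{1}{V(L)}\int_0^{2\pi}F(\rho(\theta))\,h_L(\theta)\,\big(h_L(\theta)+h_L''(\theta)\big)\,d\theta\ \ge\ F(-t_1)+F(-t_2),$$ with equality if and only if $K$ and $L$ are homothetic. -/

import Mathlib

open MeasureTheory
open scoped Pointwise

noncomputable section

/-- The Euclidean plane. -/
abbrev Plane : Type := EuclideanSpace ℝ (Fin 2)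

/-- The unit vector `u(θ) = (cos θ, sin θ)`. -/
def unitDir (θ : ℝ) : Plane := !₂[Real.cos θ, Real.sin θ]

/-- The support function `h_K(θ) = sup_{x ∈ K} ⟨x, u(θ)⟩`. -/
def supportFn (K : Set Plane) (θ : ℝ) : ℝ :=
  sSup ((fun x : Plane => inner ℝ x (unitDir θ)) '' K)

/-- The radius of curvature `h_K(θ) + h_K''(θ)` of the boundary of `K` at the point with outer
unit normal `u(θ)`. -/
def curvRadius (K : Set Plane) (θ : ℝ) : ℝ :=
  supportFn K θ + deriv (deriv (supportFn K)) θ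

/-- The relative curvature radius `ρ(θ)` of `K` with respect to `L`. -/
def relCurvRadius (K L : Set Plane) (θ : ℝ) : ℝ :=
  curvRadius K θ / curvRadius L θ

/-- `K` is a smooth, planar strictly convex body. Mathlib's `ConvexBody` gives convexity and
compactness; the origin lies in `K` and `K` has nonempty interior. Smoothness means that the support
function is `C²` with everywhere positive radius of curvature. -/
structure IsSmoothStrictlyConvexBody (K : ConvexBody Plane) : Prop where
  zero_mem : (0 : Plane) ∈ (K : Set Plane)
  interior_nonempty : (interior (K : Set Plane)).Nonempty
  strictConvex : StrictConvex ℝ (K : Set Plane)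
  contDiff_supportFn : ContDiff ℝ 2 (supportFn K)
  curvRadius_pos : ∀ θ : ℝ, 0 < curvRadius K θ

/-- The inradius of `K` with respect to `L`: the largest `t > 0` such that some translate of `tL`
is contained in `K`. -/
def relInradius (K L : Set Plane) : ℝ :=
  sSup {t : ℝ | 0 < t ∧ ∃ x : Plane, {x} + t • L ⊆ K}

/-- The outradius of `K` with respect to `L`: the smallest `t > 0` such that some translate of `tL`
contains `K`. -/
def relOutradius (K L : Set Plane) : ℝ :=
  sInf {t : ℝ | 0 < t ∧ ∃ x : Plane, K ⊆ {x} + t • L}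

/-- `K` and `L` are at a dilation position: `o ∈ K ∩ L` and `r(K,L) L ⊆ K ⊆ R(K,L) L`. -/
def IsAtDilationPosition (K L : Set Plane) : Prop :=
  (0 : Plane) ∈ K ∩ L ∧ relInradius K L • L ⊆ K ∧ K ⊆ relOutradius K L • L

/-- `K` and `L` are homothetic: `K` is a translate of a positive dilate of `L`. -/
def AreHomothetic (K L : Set Plane) : Prop :=
  ∃ (x : Plane) (c : ℝ), 0 < c ∧ K = {x} + c • L

/-- The area `V(S)`: Lebesgue measure as a real number. -/
def area (S : Set Plane) : ℝ := (volume : Measure Plane).real S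

/-- The mixed area `V(K,L)`, by polarization of the area. -/
def mixedArea (K L : Set Plane) : ℝ := (area (K + L) - area K - area L) / 2

/-- The relative Steiner polynomial `V(K) + 2 V(K,L) t + V(L) t²` of `K` with respect to `L`. -/
def steinerPoly (K L : Set Plane) : Polynomial ℝ :=
  Polynomial.C (area K) + Polynomial.C (2 * mixedArea K L) * Polynomial.X
    + Polynomial.C (area L) * Polynomial.X ^ 2

end

/-!
The plane enters only through two facts about support functions `h_K`, `h_L` and the curvature radii
`κ = h + h''`. First, `V(K) = ½ ∫ h_K κ_K`, by the change of variables `(s, θ) ↦ s x(θ)` with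
`x = h u + h' u'` the boundary point of normal `u`, whose Jacobian is `s h κ` (`area_eq_mixedForm`).
Since support functions add under Minkowski sums, this gives the Steiner formula and
`2 V(K, L) = ∫ h_K κ_L = ∫ h_L κ_K`.

Second, Bonnesen's inequality `V(K) - 2 s V(K, L) + s² V(L) ≤ 0` at `s = r(K, L)` and `s = R(K, L)`.
Its left side is `½ ∫ (g² - g'²)` for `g = h_K - s h_L`. As the inradius cannot be enlarged, nor the
outradius reduced, after a translation, the zeros of `g` meet every closed half circle
(`exists_contact_relInradius`, `exists_contact_relOutradius`), so they cut the circle into arcs of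
length at most `π`, on each of which Wirtinger's inequality holds (`mixedForm_self_nonpos`).

Hence the Steiner polynomial has real roots `-a ≤ -b < 0` with `b ≤ r, R ≤ a`, and the dilation
position gives `b h_L ≤ h_K ≤ a h_L` pointwise. If `b < a`, then `(a h_L - h_K) κ_L / (a - b)` and
`(h_K - b h_L) κ_L / (a - b)` are nonnegative weights with sum `h_L κ_L`. Each has mass `V(L)`, and
Vieta's formulas show that the means of `ρ` with respect to them are exactly `a` and `b`. Comparing
`F` with its supporting lines at `a` and `b` yields the inequality; equality would force `ρ` into
`{a, b}`, hence to be constant by continuity, and then `a = b`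
(`add_lt_integral_of_strictConvexOn`). If `a = b`, then `r = R = a` and the dilation position reads
`a L ⊆ K ⊆ a L`.
-/

noncomputable section

/-! ### Supporting lines of strictly convex functions -/

lemma StrictConvexOn.exists_supportLine {S : Set ℝ} {F : ℝ → ℝ} (hF : StrictConvexOn ℝ S F)
    {p : ℝ} (hp : p ∈ interior S) :
    ∃ m : ℝ, ∀ x ∈ S, x ≠ p → 0 < F x - F p - m * (x - p) := by
  refine ⟨derivWithin F (Set.Ioi p) p, fun x hx hxp => ?_⟩
  have hpS := interior_subset hp
  rcases lt_or_gt_of_ne hxp with h | h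
  · have h1 := hF.slope_lt_leftDeriv hx hpS h
      (hF.convexOn.differentiableWithinAt_Iio_of_mem_interior hp)
    have h2 := hF.convexOn.leftDeriv_le_rightDeriv_of_mem_interior hp
    have h3 := h1.trans_le h2
    rw [slope_def_field, div_lt_iff₀ (by linarith)] at h3
    linarith
  · have h1 := hF.rightDeriv_lt_slope hpS hx h
      (hF.convexOn.differentiableWithinAt_Ioi_of_mem_interior hp)
    rw [slope_def_field, lt_div_iff₀ (by linarith)] at h1
    linarith

/-! ### Wirtinger's inequality and the quadratic form of the area -/

/-- The bilinear form `∫ (f g - f' g')` over one period. At the support functions of two bodies it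
is twice their mixed area. -/
def mixedForm (f g : ℝ → ℝ) : ℝ :=
  ∫ θ in (0 : ℝ)..(2 * Real.pi), (f θ * g θ - deriv f θ * deriv g θ)

lemma Function.Periodic.deriv_real {f : ℝ → ℝ} {c : ℝ} (hf : Function.Periodic f c) :
    Function.Periodic (deriv f) c := by
  intro x
  rw [← deriv_comp_add_const f c x]
  congr 1
  exact funext hf

lemma mixedForm_eq_integral {f g : ℝ → ℝ} (hf : ContDiff ℝ 1 f) (hg : ContDiff ℝ 2 g)
    (hfp : Function.Periodic f (2 * Real.pi)) (hgp : Function.Periodic g (2 * Real.pi)) :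
    mixedForm f g = ∫ θ in (0 : ℝ)..(2 * Real.pi), f θ * (g θ + deriv (deriv g) θ) := by
  have hg1 : ContDiff ℝ 1 (deriv g) := ((contDiff_succ_iff_deriv (n := 1)).1 hg).2.2
  have c1 : Continuous (deriv f) := hf.continuous_deriv le_rfl
  have c2 : Continuous (deriv (deriv g)) := hg1.continuous_deriv le_rfl
  have parts := intervalIntegral.integral_mul_deriv_eq_deriv_mul
    (a := 0) (b := 2 * Real.pi) (u := f) (v := deriv g) (u' := deriv f) (v' := deriv (deriv g))
    (fun x _ => (hf.differentiable (by norm_num) x).hasDerivAt)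
    (fun x _ => (hg1.differentiable (by norm_num) x).hasDerivAt)
    (c1.intervalIntegrable _ _) (c2.intervalIntegrable _ _)
  have e1 : f (2 * Real.pi) = f 0 := by simpa using hfp 0
  have e2 : deriv g (2 * Real.pi) = deriv g 0 := by simpa using hgp.deriv_real 0
  have cf := hf.continuous
  have cg := hg.continuous
  have cg1 := hg1.continuous
  simp only [mixedForm, mul_add]
  rw [intervalIntegral.integral_sub (Continuous.intervalIntegrable (by fun_prop) _ _)
      (Continuous.intervalIntegrable (by fun_prop) _ _),
    intervalIntegral.integral_add (Continuous.intervalIntegrable (by fun_prop) _ _)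
      (Continuous.intervalIntegrable (by fun_prop) _ _), parts, e1, e2]
  ring

lemma mixedForm_comm (f g : ℝ → ℝ) : mixedForm f g = mixedForm g f := by
  simp only [mixedForm, mul_comm]

lemma mixedForm_add_mul_self {f g : ℝ → ℝ} (hf : ContDiff ℝ 1 f) (hg : ContDiff ℝ 1 g) (c : ℝ) :
    mixedForm (fun θ => f θ + c * g θ) (fun θ => f θ + c * g θ) =
      mixedForm f f + 2 * c * mixedForm f g + c ^ 2 * mixedForm g g := by
  have hd : ∀ θ, deriv (fun θ => f θ + c * g θ) θ = deriv f θ + c * deriv g θ := fun θ =>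
    ((hf.differentiable (by norm_num) θ).hasDerivAt.add
      ((hg.differentiable (by norm_num) θ).hasDerivAt.const_mul c)).deriv
  have c1 : Continuous (deriv f) := hf.continuous_deriv le_rfl
  have c2 : Continuous (deriv g) := hg.continuous_deriv le_rfl
  have cf := hf.continuous
  have cg := hg.continuous
  simp only [mixedForm, hd]
  rw [← intervalIntegral.integral_const_mul, ← intervalIntegral.integral_const_mul,
    ← intervalIntegral.integral_add, ← intervalIntegral.integral_add]
  · congr 1; ext θ; ring
  all_goals exact Continuous.intervalIntegrable (by fun_prop) _ _

/-- Wirtinger's inequality with Dirichlet conditions on an interval of length at most `π`. -/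
lemma integral_sq_le_integral_deriv_sq {g : ℝ → ℝ} (hg : ContDiff ℝ 1 g) {a b : ℝ} (hab : a ≤ b)
    (hlen : b - a ≤ Real.pi) (ha : g a = 0) (hb : g b = 0) :
    ∫ θ in a..b, g θ ^ 2 ≤ ∫ θ in a..b, deriv g θ ^ 2 := by
  have cg := hg.continuous
  have c1 : Continuous (deriv g) := hg.continuous_deriv le_rfl
  -- The factor `l < 1` keeps the tangent finite at the endpoints when the length is exactly `π`.
  have key : ∀ l ∈ Set.Ioo (0 : ℝ) 1,
      l ^ 2 * ∫ θ in a..b, g θ ^ 2 ≤ ∫ θ in a..b, deriv g θ ^ 2 := by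
    rintro l ⟨hl0, hl1⟩
    set m := (a + b) / 2 with hm
    have hcos : ∀ θ ∈ Set.uIcc a b, Real.cos (l * (θ - m)) ≠ 0 := by
      intro θ hθ
      rw [Set.uIcc_of_le hab] at hθ
      have h1 : |θ - m| ≤ Real.pi / 2 := by
        rw [abs_le]; constructor <;> linarith [hθ.1, hθ.2]
      have h2 : |l * (θ - m)| < Real.pi / 2 := by
        rw [abs_mul, abs_of_pos hl0]
        nlinarith [Real.pi_pos, abs_nonneg (θ - m)]
      rw [abs_lt] at h2
      exact (Real.cos_pos_of_mem_Ioo ⟨by linarith, h2.2⟩).ne'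
    set T : ℝ → ℝ := fun θ => Real.tan (l * (θ - m)) with hT
    have hTd : ∀ θ ∈ Set.uIcc a b, HasDerivAt T (l * (1 + T θ ^ 2)) θ := by
      intro θ hθ
      have h1 : HasDerivAt (fun θ : ℝ => l * (θ - m)) l θ := by
        simpa using ((hasDerivAt_id θ).sub_const m).const_mul l
      have h2 := (Real.hasDerivAt_tan (hcos θ hθ)).comp θ h1
      convert! h2 using 1
      have := Real.one_add_tan_sq_mul_cos_sq_eq_one (hcos θ hθ)
      have hne := hcos θ hθ
      simp only [hT]
      field_simp
      linear_combination this
    have hTc : ContinuousOn T (Set.uIcc a b) := fun θ hθ =>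
      (hTd θ hθ).continuousAt.continuousWithinAt
    have hftc := intervalIntegral.integral_eq_sub_of_hasDerivAt (a := a) (b := b)
      (f := fun θ => g θ ^ 2 * (l * T θ))
      (f' := fun θ => 2 * g θ * deriv g θ * (l * T θ) + g θ ^ 2 * (l * (l * (1 + T θ ^ 2))))
      (fun θ hθ => by
        have := (((hg.differentiable (by norm_num) θ).hasDerivAt.pow 2).mul
          ((hTd θ hθ).const_mul l))
        convert! this using 1
        simp)
      (ContinuousOn.intervalIntegrable (by fun_prop))
    simp only [ha, hb] at hftc
    have hsq : 0 ≤ ∫ θ in a..b, (deriv g θ + l * g θ * T θ) ^ 2 :=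
      intervalIntegral.integral_nonneg hab fun _ _ => sq_nonneg _
    have hsum : ∫ θ in a..b, (deriv g θ + l * g θ * T θ) ^ 2 =
        (∫ θ in a..b, deriv g θ ^ 2) - l ^ 2 * (∫ θ in a..b, g θ ^ 2) +
        ∫ θ in a..b, (2 * g θ * deriv g θ * (l * T θ) +
          g θ ^ 2 * (l * (l * (1 + T θ ^ 2)))) := by
      rw [← intervalIntegral.integral_const_mul, ← intervalIntegral.integral_sub,
        ← intervalIntegral.integral_add]
      · congr 1; ext θ; ring
      all_goals exact ContinuousOn.intervalIntegrable (by fun_prop)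
    rw [hftc] at hsum
    linarith
  have hlim : Filter.Tendsto (fun l : ℝ => l ^ 2 * ∫ θ in a..b, g θ ^ 2)
      (nhdsWithin 1 (Set.Iio 1)) (nhds (1 ^ 2 * ∫ θ in a..b, g θ ^ 2)) :=
    (Continuous.tendsto (by fun_prop) 1).mono_left nhdsWithin_le_nhds
  rw [one_pow, one_mul] at hlim
  refine le_of_tendsto hlim ?_
  filter_upwards [Ioo_mem_nhdsLT (zero_lt_one (α := ℝ))] with l hl using key l hl

/-- If the zeros of `g` meet every closed half circle, then they cut the circle into arcs of length
at most `π`, and Wirtinger's inequality applies on each of them. -/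
lemma mixedForm_self_nonpos {g : ℝ → ℝ} (hg : ContDiff ℝ 1 g)
    (hgp : Function.Periodic g (2 * Real.pi))
    (hz : ∀ φ : ℝ, ∃ z ∈ Set.Icc φ (φ + Real.pi), g z = 0) : mixedForm g g ≤ 0 := by
  have cg := hg.continuous
  have c1 : Continuous (deriv g) := hg.continuous_deriv le_rfl
  have hpi := Real.pi_pos
  obtain ⟨a, -, ha⟩ := hz 0
  have hclosed : IsClosed {z | g z = 0} := isClosed_eq cg continuous_const
  have ha2 : g (a + 2 * Real.pi) = 0 := by rw [hgp a, ha]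
  -- `b` is the last zero in the half circle after `a`, and `c` the first zero in the next one.
  obtain ⟨b, ⟨hbI, hb⟩, hbmax⟩ := (isCompact_Icc.inter_right hclosed).exists_isGreatest
    (s := Set.Icc a (a + Real.pi) ∩ {z | g z = 0}) ⟨a, ⟨le_rfl, by linarith⟩, ha⟩
  obtain ⟨c, ⟨hcI, hc⟩, hcmin⟩ := (isCompact_Icc.inter_right hclosed).exists_isLeast
    (s := Set.Icc (a + Real.pi) (a + 2 * Real.pi) ∩ {z | g z = 0})
    ⟨a + 2 * Real.pi, ⟨by linarith, le_rfl⟩, ha2⟩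
  have hbc : c - b ≤ Real.pi := by
    by_contra! hlt
    obtain ⟨z, hzI, hz0⟩ := hz ((b + c) / 2 - Real.pi / 2)
    rcases le_total z (a + Real.pi) with h | h
    · have := hbmax ⟨⟨by linarith [hzI.1, hbI.1], h⟩, hz0⟩
      linarith [hzI.1]
    · have := hcmin ⟨⟨h, by linarith [hzI.2, hcI.2]⟩, hz0⟩
      linarith [hzI.2]
  have hper : Function.Periodic (fun θ => g θ * g θ - deriv g θ * deriv g θ) (2 * Real.pi) := by
    intro θ
    simp only [hgp θ, hgp.deriv_real θ]
  have arc : ∀ x y, x ≤ y → y - x ≤ Real.pi → g x = 0 → g y = 0 →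
      ∫ θ in x..y, (g θ * g θ - deriv g θ * deriv g θ) ≤ 0 := by
    intro x y hxy hl hx hy
    have := integral_sq_le_integral_deriv_sq hg hxy hl hx hy
    simp only [← sq]
    rw [intervalIntegral.integral_sub (Continuous.intervalIntegrable (by fun_prop) _ _)
      (Continuous.intervalIntegrable (by fun_prop) _ _)]
    linarith
  have hint : ∀ x y, IntervalIntegrable (fun θ => g θ * g θ - deriv g θ * deriv g θ)
      volume x y := fun x y => Continuous.intervalIntegrable (by fun_prop) _ _
  have hshift := hper.intervalIntegral_add_eq 0 a
  rw [zero_add] at hshift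
  rw [mixedForm, hshift, ← intervalIntegral.integral_add_adjacent_intervals (hint a b) (hint b _),
    ← intervalIntegral.integral_add_adjacent_intervals (hint b c) (hint c _)]
  have h1 := arc a b hbI.1 (by linarith [hbI.2]) ha hb
  have h2 := arc b c (by linarith [hbI.2, hcI.1]) hbc hb hc
  have h3 := arc c (a + 2 * Real.pi) hcI.2 (by linarith [hcI.1]) hc ha2
  linarith

/-! ### Support functions -/

lemma inner_unitDir (p : Plane) (θ : ℝ) :
    inner ℝ p (unitDir θ) = p 0 * Real.cos θ + p 1 * Real.sin θ := by
  simp [unitDir, PiLp.inner_apply, Fin.sum_univ_two, mul_comm]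

lemma continuous_inner_unitDir (p : Plane) : Continuous fun θ => inner ℝ p (unitDir θ) := by
  simp only [inner_unitDir]
  fun_prop

lemma unitDir_periodic : Function.Periodic unitDir (2 * Real.pi) := fun θ => by
  simp [unitDir]

lemma supportFn_periodic (M : Set Plane) : Function.Periodic (supportFn M) (2 * Real.pi) :=
  fun θ => by simp only [supportFn, unitDir_periodic θ]

lemma inner_le_supportFn {M : Set Plane} (hM : IsCompact M) {p : Plane} (hp : p ∈ M) (θ : ℝ) :
    inner ℝ p (unitDir θ) ≤ supportFn M θ :=
  le_csSup (hM.image (by fun_prop)).bddAbove ⟨p, hp, rfl⟩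

lemma exists_inner_eq_supportFn {M : Set Plane} (hM : IsCompact M) (hne : M.Nonempty) (θ : ℝ) :
    ∃ p ∈ M, inner ℝ p (unitDir θ) = supportFn M θ := by
  obtain ⟨p, hp, h⟩ := hM.exists_sSup_image_eq hne
    (f := fun x : Plane => inner ℝ x (unitDir θ)) (by fun_prop)
  exact ⟨p, hp, h.symm⟩

lemma supportFn_nonneg {M : Set Plane} (hM : IsCompact M) (h0 : (0 : Plane) ∈ M) (θ : ℝ) :
    0 ≤ supportFn M θ := by
  simpa using inner_le_supportFn hM h0 θ

lemma exists_eq_norm_smul_unitDir (v : Plane) : ∃ θ : ℝ, v = ‖v‖ • unitDir θ := by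
  refine ⟨Complex.arg ⟨v 0, v 1⟩, ?_⟩
  have hn : ‖v‖ = ‖(⟨v 0, v 1⟩ : ℂ)‖ := by
    rw [EuclideanSpace.norm_eq, Complex.norm_def, Complex.normSq_mk, Fin.sum_univ_two]
    simp [sq]
  ext i
  fin_cases i
  · simp [unitDir, hn, Complex.norm_mul_cos_arg]
  · simp [unitDir, hn, Complex.norm_mul_sin_arg]

/-- A compact convex set is the intersection of its supporting half planes. -/
lemma mem_of_forall_inner_le {M : Set Plane} (hM : IsCompact M) (hc : Convex ℝ M)
    (hne : M.Nonempty) {p : Plane} (h : ∀ θ, inner ℝ p (unitDir θ) ≤ supportFn M θ) : p ∈ M := by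
  by_contra hp
  obtain ⟨f, u, hlt, hu⟩ := geometric_hahn_banach_closed_point hc hM.isClosed hp
  set v := (InnerProductSpace.toDual ℝ Plane).symm f with hv
  have hf : ∀ x, f x = inner ℝ x v := fun x => by
    rw [real_inner_comm, hv, InnerProductSpace.toDual_symm_apply]
  obtain ⟨θ, hθ⟩ := exists_eq_norm_smul_unitDir v
  obtain ⟨q, hq, hqe⟩ := exists_inner_eq_supportFn hM hne θ
  have h1 := hlt q hq
  rw [hf, hθ, inner_smul_right, hqe] at h1
  rw [hf, hθ, inner_smul_right] at hu
  have := mul_le_mul_of_nonneg_left (h θ) (norm_nonneg v)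
  linarith

lemma supportFn_add_smul {M N : Set Plane} (hM : IsCompact M) (hN : IsCompact N)
    (hMne : M.Nonempty) (hNne : N.Nonempty) {t : ℝ} (ht : 0 ≤ t) (θ : ℝ) :
    supportFn (M + t • N) θ = supportFn M θ + t * supportFn N θ := by
  apply le_antisymm
  · refine csSup_le ((hMne.add hNne.smul_set).image _) ?_
    rintro _ ⟨_, ⟨p, hp, _, ⟨q, hq, rfl⟩, rfl⟩, rfl⟩
    have h1 := inner_le_supportFn hM hp θ
    have h2 := mul_le_mul_of_nonneg_left (inner_le_supportFn hN hq θ) ht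
    simp only [inner_add_left, real_inner_smul_left]
    linarith
  · obtain ⟨p, hp, hpe⟩ := exists_inner_eq_supportFn hM hMne θ
    obtain ⟨q, hq, hqe⟩ := exists_inner_eq_supportFn hN hNne θ
    have := inner_le_supportFn (hM.add (hN.smul t))
      (Set.add_mem_add hp (Set.smul_mem_smul_set hq)) θ
    simpa only [inner_add_left, real_inner_smul_left, hpe, hqe] using this

lemma supportFn_singleton (x : Plane) (θ : ℝ) : supportFn {x} θ = inner ℝ x (unitDir θ) := by
  simp [supportFn]

lemma supportFn_singleton_add_smul {N : Set Plane} (hN : IsCompact N) (hNne : N.Nonempty)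
    (x : Plane) {t : ℝ} (ht : 0 ≤ t) (θ : ℝ) :
    supportFn ({x} + t • N) θ = inner ℝ x (unitDir θ) + t * supportFn N θ := by
  rw [supportFn_add_smul isCompact_singleton hN (Set.singleton_nonempty x) hNne ht,
    supportFn_singleton]

lemma supportFn_smul {N : Set Plane} (hN : IsCompact N) (hNne : N.Nonempty)
    {t : ℝ} (ht : 0 ≤ t) (θ : ℝ) : supportFn (t • N) θ = t * supportFn N θ := by
  simpa using supportFn_singleton_add_smul hN hNne 0 ht θ

lemma supportFn_mono {M N : Set Plane} (hN : IsCompact N) (hMne : M.Nonempty) (h : M ⊆ N) (θ : ℝ) :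
    supportFn M θ ≤ supportFn N θ :=
  csSup_le_csSup (hN.image (by fun_prop)).bddAbove (hMne.image _) (Set.image_mono h)

lemma subset_of_supportFn_le {M N : Set Plane} (hM : IsCompact M) (hN : IsCompact N)
    (hNc : Convex ℝ N) (hNne : N.Nonempty) (h : ∀ θ, supportFn M θ ≤ supportFn N θ) : M ⊆ N :=
  fun _ hp => mem_of_forall_inner_le hN hNc hNne fun θ => (inner_le_supportFn hM hp θ).trans (h θ)

lemma Function.Periodic.exists_pos_forall_le {f : ℝ → ℝ} {c : ℝ} (hf : Function.Periodic f c)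
    (hc : c ≠ 0) (hcont : Continuous f) (hpos : ∀ x, 0 < f x) : ∃ ε > 0, ∀ x, ε ≤ f x := by
  obtain ⟨ε, ⟨x, rfl⟩, hε⟩ := (hf.compact_of_continuous hc hcont).exists_isLeast
    (Set.range_nonempty f)
  exact ⟨f x, hpos x, fun y => hε ⟨y, rfl⟩⟩

lemma Function.Periodic.exists_pos_forall_abs_le {f : ℝ → ℝ} {c : ℝ} (hf : Function.Periodic f c)
    (hc : c ≠ 0) (hcont : Continuous f) : ∃ C > 0, ∀ x, |f x| ≤ C := by
  obtain ⟨C, h0, hC⟩ := (hf.isBounded_of_continuous hc hcont).exists_pos_norm_le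
  exact ⟨C, h0, fun x => hC _ ⟨x, rfl⟩⟩

/-! ### The area in terms of the support function -/

/-- The point `h u + h' u'` of the plane, in coordinates. If `h` is the support function of a convex
body, this is the boundary point with outer normal `u(θ)`. -/
def contactPoint (h : ℝ → ℝ) (θ : ℝ) : ℝ × ℝ :=
  (h θ * Real.cos θ - deriv h θ * Real.sin θ, h θ * Real.sin θ + deriv h θ * Real.cos θ)

/-- Where the support function is differentiable, the contact point is the only point of the body
on the supporting line. -/
lemma eq_contactPoint {M : Set Plane} (hM : IsCompact M) (hd : Differentiable ℝ (supportFn M))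
    {p : Plane} (hp : p ∈ M) {θ : ℝ} (h : inner ℝ p (unitDir θ) = supportFn M θ) :
    (p 0, p 1) = contactPoint (supportFn M) θ := by
  have hmin : IsLocalMin
      (fun φ => supportFn M φ - (p 0 * Real.cos φ + p 1 * Real.sin φ)) θ := by
    refine Filter.Eventually.of_forall fun φ => ?_
    have h1 := inner_le_supportFn hM hp φ
    simp only [inner_unitDir] at h h1
    linarith
  have hder := hmin.hasDerivAt_eq_zero ((hd θ).hasDerivAt.sub
    (((Real.hasDerivAt_cos θ).const_mul (p 0)).add ((Real.hasDerivAt_sin θ).const_mul (p 1))))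
  rw [inner_unitDir] at h
  have hcs := Real.sin_sq_add_cos_sq θ
  have hd' : deriv (supportFn M) θ = -p 0 * Real.sin θ + p 1 * Real.cos θ := by linarith
  simp only [contactPoint, ← h, hd', Prod.mk.injEq]
  constructor
  · linear_combination -(p 0) * hcs
  · linear_combination -(p 1) * hcs

lemma contactPoint_mem {M : Set Plane} (hM : IsCompact M) (hne : M.Nonempty)
    (hd : Differentiable ℝ (supportFn M)) (θ : ℝ) :
    ∃ p ∈ M, inner ℝ p (unitDir θ) = supportFn M θ ∧
      (p 0, p 1) = contactPoint (supportFn M) θ := by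
  obtain ⟨p, hp, h⟩ := exists_inner_eq_supportFn hM hne θ
  exact ⟨p, hp, h, eq_contactPoint hM hd hp h⟩

lemma contactPoint_periodic {h : ℝ → ℝ} (hp : Function.Periodic h (2 * Real.pi)) :
    Function.Periodic (contactPoint h) (2 * Real.pi) := fun θ => by
  simp [contactPoint, hp θ, hp.deriv_real θ]

lemma hasDerivAt_contactPoint {h : ℝ → ℝ} (hh : ContDiff ℝ 2 h) (θ : ℝ) :
    HasDerivAt (fun θ => h θ * Real.cos θ - deriv h θ * Real.sin θ)
      (-(h θ + deriv (deriv h) θ) * Real.sin θ) θ ∧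
    HasDerivAt (fun θ => h θ * Real.sin θ + deriv h θ * Real.cos θ)
      ((h θ + deriv (deriv h) θ) * Real.cos θ) θ := by
  have h0 := (hh.differentiable (by norm_num) θ).hasDerivAt
  have hh1 : ContDiff ℝ 1 (deriv h) := ((contDiff_succ_iff_deriv (n := 1)).1 hh).2.2
  have h1 := (hh1.differentiable (by norm_num) θ).hasDerivAt
  constructor
  · convert! (h0.mul (Real.hasDerivAt_cos θ)).sub (h1.mul (Real.hasDerivAt_sin θ)) using 1
    ring
  · convert! (h0.mul (Real.hasDerivAt_sin θ)).add (h1.mul (Real.hasDerivAt_cos θ)) using 1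
    ring

lemma contactPoint_ne_of_lt {h : ℝ → ℝ} (hh : ContDiff ℝ 2 h)
    (hpos : ∀ θ, 0 < h θ + deriv (deriv h) θ) {a b : ℝ} (hab : a < b) (hlen : b - a ≤ Real.pi) :
    contactPoint h a ≠ contactPoint h b := by
  intro heq
  -- Along the arc the contact point moves strictly forward in the tangent direction at its midpoint.
  set m := (a + b) / 2 with hm
  have hder : ∀ θ, HasDerivAt
      (fun θ => (h θ * Real.cos θ - deriv h θ * Real.sin θ) * (-Real.sin m) +
        (h θ * Real.sin θ + deriv h θ * Real.cos θ) * Real.cos m)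
      ((h θ + deriv (deriv h) θ) * Real.cos (θ - m)) θ := fun θ => by
    convert! ((hasDerivAt_contactPoint hh θ).1.mul_const (-Real.sin m)).add
      ((hasDerivAt_contactPoint hh θ).2.mul_const (Real.cos m)) using 1
    rw [Real.cos_sub]; ring
  have hmono := strictMonoOn_of_deriv_pos (convex_Icc a b)
    (fun θ _ => (hder θ).continuousAt.continuousWithinAt) (fun θ hθ => by
      rw [interior_Icc] at hθ
      rw [(hder θ).deriv]
      exact mul_pos (hpos θ) (Real.cos_pos_of_mem_Ioo
        ⟨by linarith [hθ.1, hθ.2], by linarith [hθ.1, hθ.2]⟩))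
  have hlt := hmono (Set.left_mem_Icc.2 hab.le) (Set.right_mem_Icc.2 hab.le) hab
  simp only [contactPoint, Prod.mk.injEq] at heq
  simp only [heq.1, heq.2, lt_irrefl] at hlt

lemma contactPoint_injOn {h : ℝ → ℝ} (hh : ContDiff ℝ 2 h) (hp : Function.Periodic h (2 * Real.pi))
    (hpos : ∀ θ, 0 < h θ + deriv (deriv h) θ) :
    Set.InjOn (contactPoint h) (Set.Ico 0 (2 * Real.pi)) := by
  have main : ∀ a ∈ Set.Ico 0 (2 * Real.pi), ∀ b ∈ Set.Ico 0 (2 * Real.pi), a < b →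
      contactPoint h a ≠ contactPoint h b := by
    intro a ha b hb hab
    by_cases hl : b - a ≤ Real.pi
    · exact contactPoint_ne_of_lt hh hpos hab hl
    · rw [← contactPoint_periodic hp a]
      exact (contactPoint_ne_of_lt hh hpos (by linarith [ha.1, hb.2]) (by linarith)).symm
  intro a ha b hb hab
  rcases lt_trichotomy a b with h | h | h
  · exact absurd hab (main a ha b hb h)
  · exact h
  · exact absurd hab.symm (main b hb a ha h)

/-- In a compact convex set every point other than the origin is `s • x` for some `s ∈ (0, 1]` and
some point `x` of the set on a supporting line. -/
lemma exists_smul_contact {M : Set Plane} (hM : IsCompact M) (hc : Convex ℝ M)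
    (hcont : Continuous (supportFn M)) {p : Plane} (hp : p ∈ M)
    (hp0 : p ≠ 0) : ∃ t : ℝ, 1 ≤ t ∧ t • p ∈ M ∧
      ∃ θ ∈ Set.Ico 0 (2 * Real.pi), inner ℝ (t • p) (unitDir θ) = supportFn M θ := by
  have hpi := Real.pi_pos
  have hcomp : IsCompact ((fun t : ℝ => t • p) ⁻¹' M) :=
    (isClosedEmbedding_smul_left hp0).isCompact_preimage hM
  obtain ⟨t, ht, htmax⟩ := hcomp.exists_isGreatest ⟨1, by simpa using hp⟩
  refine ⟨t, htmax (by simpa using hp), ht, ?_⟩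
  by_contra! hno
  have hper : Function.Periodic (fun θ => supportFn M θ - inner ℝ (t • p) (unitDir θ))
      (2 * Real.pi) := fun θ => by simp only [supportFn_periodic M θ, unitDir_periodic θ]
  obtain ⟨ε, hε, hle⟩ := hper.exists_pos_forall_le (by positivity)
    (hcont.sub (continuous_inner_unitDir _)) (fun θ => by
      obtain ⟨φ, hφ, he⟩ := hper.exists_mem_Ico₀ (by positivity) θ
      rw [he]
      exact sub_pos.2 (lt_of_le_of_ne (inner_le_supportFn hM ht φ) (hno φ hφ)))
  have hperp : Function.Periodic (fun θ => inner ℝ p (unitDir θ)) (2 * Real.pi) := fun θ => by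
    simp only [unitDir_periodic θ]
  obtain ⟨C, hC, hb⟩ := hperp.exists_pos_forall_abs_le (by positivity) (continuous_inner_unitDir p)
  have hmem : (t + ε / C) • p ∈ M := by
    refine mem_of_forall_inner_le hM hc ⟨p, hp⟩ fun θ => ?_
    have h1 := hle θ
    have h2 := mul_le_mul_of_nonneg_left ((le_abs_self _).trans (hb θ)) (div_pos hε hC).le
    rw [div_mul_cancel₀ _ hC.ne'] at h2
    rw [add_smul, inner_add_left, real_inner_smul_left p _ (ε / C)]
    linarith
  have := htmax hmem
  linarith [div_pos hε hC]

lemma measureReal_preimage_coordinates {M : Set Plane} (hM : MeasurableSet M) :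
    (volume : Measure (ℝ × ℝ)).real ((fun q : ℝ × ℝ => (!₂[q.1, q.2] : Plane)) ⁻¹' M) = area M := by
  have hmp : MeasurePreserving (fun q : ℝ × ℝ => (!₂[q.1, q.2] : Plane)) :=
    (PiLp.volume_preserving_toLp (Fin 2)).comp (volume_preserving_finTwoArrow ℝ).symm
  rw [area, Measure.real, Measure.real, hmp.measure_preimage hM.nullMeasurableSet]

/-- The derivative of `(s, θ) ↦ s x(θ)`, where `x` is the contact point. -/
def fderivCone (h : ℝ → ℝ) (q : ℝ × ℝ) : ℝ × ℝ →L[ℝ] ℝ × ℝ :=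
  (Matrix.toLin (.finTwoProd ℝ) (.finTwoProd ℝ)
    !![(contactPoint h q.2).1, q.1 * (-(h q.2 + deriv (deriv h) q.2) * Real.sin q.2);
      (contactPoint h q.2).2, q.1 * ((h q.2 + deriv (deriv h) q.2) * Real.cos q.2)]
    ).toContinuousLinearMap

lemma hasFDerivAt_cone {h : ℝ → ℝ} (hh : ContDiff ℝ 2 h) (q : ℝ × ℝ) :
    HasFDerivAt (fun q : ℝ × ℝ => q.1 • contactPoint h q.2) (fderivCone h q) q := by
  unfold fderivCone
  rw [Matrix.toLin_finTwoProd_toContinuousLinearMap]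
  convert!
    HasFDerivAt.prodMk (𝕜 := ℝ)
      (hasFDerivAt_fst.mul ((hasDerivAt_contactPoint hh q.2).1.comp_hasFDerivAt q hasFDerivAt_snd))
      (hasFDerivAt_fst.mul ((hasDerivAt_contactPoint hh q.2).2.comp_hasFDerivAt q hasFDerivAt_snd))
    using 2 <;>
  simp [smul_smul, add_comm, contactPoint]

lemma det_fderivCone (h : ℝ → ℝ) (q : ℝ × ℝ) :
    (fderivCone h q).det = q.1 * (h q.2 * (h q.2 + deriv (deriv h) q.2)) := by
  unfold fderivCone
  simp only [contactPoint, LinearMap.det_toContinuousLinearMap, LinearMap.det_toLin,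
    Matrix.det_fin_two_of]
  linear_combination (q.1 * (h q.2 * (h q.2 + deriv (deriv h) q.2))) * Real.sin_sq_add_cos_sq q.2

/-- The polar sector used as parameter domain. Angles with `h θ = 0` are left out: there the contact
point is the origin and the cone over it degenerates. -/
def coneDomain (h : ℝ → ℝ) : Set (ℝ × ℝ) :=
  Set.Ioc 0 1 ×ˢ (Set.Ico 0 (2 * Real.pi) ∩ {θ | 0 < h θ})

lemma measurableSet_coneDomain {h : ℝ → ℝ} (hc : Continuous h) :
    MeasurableSet (coneDomain h) :=
  measurableSet_Ioc.prod
    (measurableSet_Ico.inter (measurableSet_lt measurable_const hc.measurable))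

lemma fst_mul_cos_add_snd_mul_sin_contactPoint (h : ℝ → ℝ) (θ : ℝ) :
    (contactPoint h θ).1 * Real.cos θ + (contactPoint h θ).2 * Real.sin θ = h θ := by
  simp only [contactPoint]
  linear_combination h θ * Real.sin_sq_add_cos_sq θ

lemma contactPoint_supportFn_le {M : Set Plane} (hM : IsCompact M) (hne : M.Nonempty)
    (hd : Differentiable ℝ (supportFn M)) (θ φ : ℝ) :
    (contactPoint (supportFn M) θ).1 * Real.cos φ + (contactPoint (supportFn M) θ).2 * Real.sin φ
      ≤ supportFn M φ := by
  obtain ⟨p, hp, -, he⟩ := contactPoint_mem hM hne hd θ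
  have := inner_le_supportFn hM hp φ
  rw [inner_unitDir] at this
  rw [← he]
  exact this

lemma cone_injOn {M : Set Plane} (hM : IsCompact M) (hne : M.Nonempty)
    (hh : ContDiff ℝ 2 (supportFn M)) (hpos : ∀ θ, 0 < curvRadius M θ) :
    Set.InjOn (fun q : ℝ × ℝ => q.1 • contactPoint (supportFn M) q.2)
      (coneDomain (supportFn M)) := by
  have hd : Differentiable ℝ (supportFn M) := hh.differentiable (by norm_num)
  have scale : ∀ s t θ φ : ℝ, 0 < s → 0 < supportFn M φ →
      s • contactPoint (supportFn M) θ = t • contactPoint (supportFn M) φ → t ≤ s := by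
    intro s t θ φ hs hφ he
    have h1 := contactPoint_supportFn_le hM hne hd θ φ
    have h2 := fst_mul_cos_add_snd_mul_sin_contactPoint (supportFn M) φ
    have e1 := congrArg Prod.fst he
    have e2 := congrArg Prod.snd he
    simp only [Prod.smul_fst, Prod.smul_snd, smul_eq_mul] at e1 e2
    have h3 : t * supportFn M φ ≤ s * supportFn M φ := by
      calc t * supportFn M φ = s * ((contactPoint (supportFn M) θ).1 * Real.cos φ +
            (contactPoint (supportFn M) θ).2 * Real.sin φ) := by
            linear_combination -t * h2 - Real.cos φ * e1 - Real.sin φ * e2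
        _ ≤ s * supportFn M φ := mul_le_mul_of_nonneg_left h1 hs.le
    exact le_of_mul_le_mul_right h3 hφ
  rintro ⟨s, θ⟩ ⟨hs, hθ, hθp⟩ ⟨t, φ⟩ ⟨ht, hφ, hφp⟩ he
  simp only at hs hθ hθp ht hφ hφp he
  have hst : s = t := le_antisymm (scale t s φ θ ht.1 hθp he.symm) (scale s t θ φ hs.1 hφp he)
  subst hst
  have := contactPoint_injOn hh (supportFn_periodic M) hpos hθ hφ
    (smul_right_injective _ hs.1.ne' he)
  rw [this]

lemma image_coneDomain {M : Set Plane} (hM : IsCompact M) (hc : Convex ℝ M) (h0 : (0 : Plane) ∈ M)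
    (hh : ContDiff ℝ 2 (supportFn M)) :
    (fun q : ℝ × ℝ => q.1 • contactPoint (supportFn M) q.2) '' coneDomain (supportFn M) =
      ((fun q : ℝ × ℝ => (!₂[q.1, q.2] : Plane)) ⁻¹' M) \ {0} := by
  have hd : Differentiable ℝ (supportFn M) := hh.differentiable (by norm_num)
  ext ⟨x, y⟩
  constructor
  · rintro ⟨⟨s, θ⟩, ⟨hs, hθ, hθp⟩, he⟩
    simp only at hs hθ hθp he
    obtain ⟨p, hp, hpe, hpc⟩ := contactPoint_mem hM ⟨0, h0⟩ hd θ
    rw [← hpc] at he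
    simp only [Prod.smul_mk, smul_eq_mul, Prod.mk.injEq] at he
    have hsp : (!₂[x, y] : Plane) = s • p := by
      ext i; fin_cases i <;> simp [← he.1, ← he.2]
    refine ⟨?_, ?_⟩
    · simp only [Set.mem_preimage, hsp]
      exact hc.smul_mem_of_zero_mem h0 hp ⟨hs.1.le, hs.2⟩
    · intro hz
      simp only [Set.mem_singleton_iff, Prod.mk_eq_zero] at hz
      have hsp0 : s • p = 0 := by
        rw [← hsp, hz.1, hz.2]; ext i; fin_cases i <;> simp
      have hp0 : p = 0 := (smul_eq_zero.1 hsp0).resolve_left hs.1.ne'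
      rw [hp0, inner_zero_left] at hpe
      exact (ne_of_gt hθp) hpe.symm
  · rintro ⟨hp, hz⟩
    simp only [Set.mem_preimage] at hp
    have hp0 : (!₂[x, y] : Plane) ≠ 0 := by
      intro h
      apply hz
      have e0 := congrFun (congrArg WithLp.ofLp h) 0
      have e1 := congrFun (congrArg WithLp.ofLp h) 1
      simp at e0 e1
      simp [e0, e1]
    obtain ⟨t, ht, htM, θ, hθ, hθe⟩ := exists_smul_contact hM hc hh.continuous hp hp0
    have hpc := eq_contactPoint hM hd htM hθe
    have ht0 : 0 < t := by linarith
    refine ⟨(t⁻¹, θ), ⟨⟨inv_pos.2 ht0, inv_le_one_of_one_le₀ ht⟩, hθ, ?_⟩, ?_⟩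
    · refine lt_of_le_of_ne (supportFn_nonneg hM h0 θ) fun hzero => ?_
      have h1 := eq_contactPoint hM hd h0 (θ := θ) (by rw [inner_zero_left]; exact hzero)
      rw [← hpc] at h1
      simp only [Prod.mk.injEq] at h1
      have : t • (!₂[x, y] : Plane) = 0 := by
        ext i; fin_cases i
        · exact h1.1.symm
        · exact h1.2.symm
      exact hp0 ((smul_eq_zero.1 this).resolve_left ht0.ne')
    · simp only [← hpc]
      ext <;> simp [ht0.ne']

/-- The area of a body containing the origin, with `C²` support function `h` and `h + h'' > 0`, is
`½ ∫ h (h + h'')`; the integral is written with one integration by parts. -/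
lemma area_eq_mixedForm {M : Set Plane} (hM : IsCompact M) (hc : Convex ℝ M) (h0 : (0 : Plane) ∈ M)
    (hh : ContDiff ℝ 2 (supportFn M)) (hpos : ∀ θ, 0 < curvRadius M θ) :
    area M = mixedForm (supportFn M) (supportFn M) / 2 := by
  have hpi := Real.pi_pos
  set h := supportFn M with hdef
  have hnn : ∀ θ, 0 ≤ h θ := supportFn_nonneg hM h0
  have hcv := integral_image_eq_integral_abs_det_fderiv_smul
    (volume : Measure (ℝ × ℝ)) (measurableSet_coneDomain hh.continuous)
    (fun q _ => (hasFDerivAt_cone hh q).hasFDerivWithinAt) (cone_injOn hM ⟨0, h0⟩ hh hpos)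
    (fun _ => (1 : ℝ))
  rw [image_coneDomain hM hc h0 hh, setIntegral_const,
    measureReal_congr (sdiff_null_ae_eq_self (measure_singleton _)),
    measureReal_preimage_coordinates hM.measurableSet] at hcv
  have hk : ∀ θ, h θ + deriv (deriv h) θ = curvRadius M θ := fun _ => rfl
  simp only [smul_eq_mul, mul_one, det_fderivCone, hk] at hcv
  rw [hcv, setIntegral_congr_fun (g := fun q : ℝ × ℝ => q.1 * (h q.2 * curvRadius M q.2))
    (measurableSet_coneDomain hh.continuous) (fun q hq => abs_of_nonneg
      (mul_nonneg hq.1.1.le (mul_nonneg (hnn _) (hpos _).le))), coneDomain,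
    Measure.volume_eq_prod,
    setIntegral_prod_mul (fun s : ℝ => s) (fun θ => h θ * curvRadius M θ),
    ← setIntegral_eq_of_subset_of_forall_sdiff_eq_zero (t := Set.Ico 0 (2 * Real.pi))
      measurableSet_Ico Set.inter_subset_left, integral_Ico_eq_integral_Ioc,
    ← intervalIntegral.integral_of_le zero_le_one,
    ← intervalIntegral.integral_of_le (by positivity), integral_id,
    mixedForm_eq_integral (hh.of_le (by norm_num)) hh (supportFn_periodic M)
      (supportFn_periodic M)]
  · simp only [curvRadius, hdef]
    ring
  · rintro θ ⟨hθ, hn⟩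
    have : h θ = 0 := le_antisymm (not_lt.1 fun hlt => hn ⟨hθ, hlt⟩) (hnn θ)
    simp [this]

/-! ### Areas of combinations of smooth bodies -/

lemma deriv_deriv_add_mul {f g : ℝ → ℝ} (hf : ContDiff ℝ 2 f) (hg : ContDiff ℝ 2 g) (c θ : ℝ) :
    deriv (deriv fun θ => f θ + c * g θ) θ = deriv (deriv f) θ + c * deriv (deriv g) θ := by
  have h1 : deriv (fun θ => f θ + c * g θ) = fun θ => deriv f θ + c * deriv g θ := funext fun θ =>
    ((hf.differentiable (by norm_num) θ).hasDerivAt.add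
      ((hg.differentiable (by norm_num) θ).hasDerivAt.const_mul c)).deriv
  have hf1 : ContDiff ℝ 1 (deriv f) := ((contDiff_succ_iff_deriv (n := 1)).1 hf).2.2
  have hg1 : ContDiff ℝ 1 (deriv g) := ((contDiff_succ_iff_deriv (n := 1)).1 hg).2.2
  rw [h1]
  exact ((hf1.differentiable (by norm_num) θ).hasDerivAt.add
    ((hg1.differentiable (by norm_num) θ).hasDerivAt.const_mul c)).deriv

lemma continuous_curvRadius {M : Set Plane} (hM : ContDiff ℝ 2 (supportFn M)) :
    Continuous (curvRadius M) := by
  have h1 : ContDiff ℝ 1 (deriv (supportFn M)) := ((contDiff_succ_iff_deriv (n := 1)).1 hM).2.2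
  exact hM.continuous.add (h1.continuous_deriv le_rfl)

lemma curvRadius_periodic (M : Set Plane) : Function.Periodic (curvRadius M) (2 * Real.pi) :=
  fun θ => by
    simp only [curvRadius, supportFn_periodic M θ, (supportFn_periodic M).deriv_real.deriv_real θ]

namespace IsSmoothStrictlyConvexBody

variable {K L : ConvexBody Plane}

lemma contDiff_one (hK : IsSmoothStrictlyConvexBody K) : ContDiff ℝ 1 (supportFn K) :=
  hK.contDiff_supportFn.of_le (by norm_num)

lemma area_pos (hK : IsSmoothStrictlyConvexBody K) : 0 < area K := by
  refine ENNReal.toReal_pos ?_ K.isCompact.measure_lt_top.ne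
  exact ((isOpen_interior.measure_pos volume hK.interior_nonempty).trans_le
    (measure_mono interior_subset)).ne'

lemma mixedForm_self (hK : IsSmoothStrictlyConvexBody K) :
    mixedForm (supportFn K) (supportFn K) = 2 * area K := by
  rw [area_eq_mixedForm K.isCompact K.convex hK.zero_mem hK.contDiff_supportFn hK.curvRadius_pos]
  ring

lemma area_add_smul (hK : IsSmoothStrictlyConvexBody K) (hL : IsSmoothStrictlyConvexBody L)
    {t : ℝ} (ht : 0 ≤ t) :
    area ((K : Set Plane) + t • (L : Set Plane)) =
      area K + mixedForm (supportFn K) (supportFn L) * t + area L * t ^ 2 := by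
  have hs : supportFn ((K : Set Plane) + t • (L : Set Plane)) =
      fun θ => supportFn K θ + t * supportFn L θ := funext fun θ =>
    supportFn_add_smul K.isCompact L.isCompact K.nonempty L.nonempty ht θ
  rw [area_eq_mixedForm (K.isCompact.add (L.isCompact.smul t))
    (K.convex.add (L.convex.smul t))
    (Set.mem_add.2 ⟨0, hK.zero_mem, 0, ⟨0, hL.zero_mem, smul_zero t⟩, add_zero 0⟩)
    (by rw [hs]; exact hK.contDiff_supportFn.add (contDiff_const.mul hL.contDiff_supportFn))
    (fun θ => by
      rw [curvRadius, hs, deriv_deriv_add_mul hK.contDiff_supportFn hL.contDiff_supportFn]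
      have h1 := hK.curvRadius_pos θ
      have h2 := mul_nonneg ht (hL.curvRadius_pos θ).le
      simp only [curvRadius] at h1 h2
      linarith), hs, mixedForm_add_mul_self hK.contDiff_one hL.contDiff_one,
    hK.mixedForm_self, hL.mixedForm_self]
  ring

lemma mixedForm_eq_mixedArea (hK : IsSmoothStrictlyConvexBody K)
    (hL : IsSmoothStrictlyConvexBody L) :
    mixedForm (supportFn K) (supportFn L) = 2 * mixedArea K L := by
  have := hK.area_add_smul hL zero_le_one
  rw [one_smul] at this
  rw [mixedArea, this]
  ring

lemma eval_steinerPoly (hK : IsSmoothStrictlyConvexBody K) (hL : IsSmoothStrictlyConvexBody L)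
    {t : ℝ} (ht : 0 ≤ t) :
    area ((K : Set Plane) + t • (L : Set Plane)) = (steinerPoly K L).eval t := by
  rw [hK.area_add_smul hL ht, hK.mixedForm_eq_mixedArea hL]
  simp [steinerPoly]

lemma integral_supportFn_mul_curvRadius (hK : IsSmoothStrictlyConvexBody K)
    (hL : IsSmoothStrictlyConvexBody L) :
    ∫ θ in (0 : ℝ)..(2 * Real.pi), supportFn K θ * curvRadius L θ = 2 * mixedArea K L := by
  rw [← hK.mixedForm_eq_mixedArea hL, mixedForm_eq_integral hK.contDiff_one hL.contDiff_supportFn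
    (supportFn_periodic _) (supportFn_periodic _)]
  rfl

lemma integral_supportFn_mul_curvRadius' (hK : IsSmoothStrictlyConvexBody K)
    (hL : IsSmoothStrictlyConvexBody L) :
    ∫ θ in (0 : ℝ)..(2 * Real.pi), supportFn L θ * curvRadius K θ = 2 * mixedArea K L := by
  rw [← hK.mixedForm_eq_mixedArea hL, mixedForm_comm, mixedForm_eq_integral hL.contDiff_one
    hK.contDiff_supportFn (supportFn_periodic _) (supportFn_periodic _)]
  rfl

lemma integral_supportFn_mul_curvRadius_self (hK : IsSmoothStrictlyConvexBody K) :
    ∫ θ in (0 : ℝ)..(2 * Real.pi), supportFn K θ * curvRadius K θ = 2 * area K := by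
  rw [← hK.mixedForm_self, mixedForm_eq_integral hK.contDiff_one hK.contDiff_supportFn
    (supportFn_periodic _) (supportFn_periodic _)]
  rfl

end IsSmoothStrictlyConvexBody

/-! ### Bonnesen's inequality at the inradius and at the outradius -/

/-- A nonnegative function on the circle without zeros on some closed half circle becomes positive
everywhere after subtracting a suitable small `⟨x, u(θ)⟩`, with `x` pointing to the middle of that
half circle. -/
lemma exists_sub_inner_pos {g : ℝ → ℝ} (hc : Continuous g) (hp : Function.Periodic g (2 * Real.pi))
    (hnn : ∀ θ, 0 ≤ g θ) {φ : ℝ} (hφ : ∀ z ∈ Set.Icc φ (φ + Real.pi), g z ≠ 0) :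
    ∃ x : Plane, ∃ ε > 0, ∀ θ, ε ≤ g θ - inner ℝ x (unitDir θ) := by
  have hpi := Real.pi_pos
  obtain ⟨z, hz, hmin⟩ := isCompact_Icc.exists_isMinOn
    (Set.nonempty_Icc.2 (by linarith : φ ≤ φ + Real.pi)) hc.continuousOn
  have hgz : 0 < g z := lt_of_le_of_ne (hnn z) (hφ z hz).symm
  set x : Plane := !₂[-(g z / 2) * Real.sin φ, g z / 2 * Real.cos φ] with hx
  have hin : ∀ θ, inner ℝ x (unitDir θ) = g z / 2 * Real.sin (θ - φ) := fun θ => by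
    rw [inner_unitDir, Real.sin_sub, hx]
    simp only [Matrix.cons_val_zero, Matrix.cons_val_one]
    ring
  have hper : Function.Periodic (fun θ => g θ - inner ℝ x (unitDir θ)) (2 * Real.pi) := fun θ => by
    simp only [hp θ, unitDir_periodic θ]
  refine ⟨x, hper.exists_pos_forall_le (by positivity) (hc.sub (continuous_inner_unitDir x)) ?_⟩
  intro θ
  obtain ⟨ψ, hψ, he⟩ := hper.exists_mem_Ico (by positivity) θ φ
  rw [he, hin]
  by_cases hle : ψ ≤ φ + Real.pi
  · have h1 : g z ≤ g ψ := hmin ⟨hψ.1, hle⟩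
    have h2 := mul_le_mul_of_nonneg_left (Real.sin_le_one (ψ - φ)) (half_pos hgz).le
    linarith
  · have h1 : Real.sin (ψ - φ) < 0 := by
      rw [← Real.sin_sub_two_pi]
      exact Real.sin_neg_of_neg_of_neg_pi_lt (by linarith [hψ.2]) (by linarith)
    have h2 := mul_neg_of_pos_of_neg (half_pos hgz) h1
    linarith [hnn ψ]

lemma area_singleton_add_smul (x : Plane) (t : ℝ) (N : Set Plane) :
    area ({x} + t • N) = t ^ 2 * area N := by
  have h1 : (volume : Measure Plane) ({x} + t • N) = volume (t • N) := by
    rw [Set.singleton_add, Set.image_add_left, measure_preimage_add]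
  rw [area, Measure.real, h1, Measure.addHaar_smul, ENNReal.toReal_mul,
    ENNReal.toReal_ofReal (abs_nonneg _), finrank_euclideanSpace_fin,
    abs_of_nonneg (sq_nonneg t)]
  rfl

namespace IsSmoothStrictlyConvexBody

variable {K L : ConvexBody Plane}

lemma bddAbove_relInradius (K : ConvexBody Plane) (hL : IsSmoothStrictlyConvexBody L) :
    BddAbove {t : ℝ | 0 < t ∧ ∃ x : Plane, {x} + t • (L : Set Plane) ⊆ K} := by
  refine ⟨1 + area K / area L, ?_⟩
  rintro t ⟨ht, x, hx⟩
  have hA := hL.area_pos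
  have h1 : area ({x} + t • (L : Set Plane)) ≤ area K :=
    measureReal_mono hx K.isCompact.measure_lt_top.ne
  rw [area_singleton_add_smul, ← le_div_iff₀ hA] at h1
  nlinarith [sq_nonneg (t - 1)]

/-- At the inradius the touching directions meet every closed half circle. Otherwise a translate of
a larger dilate of `L` would fit into `K`. -/
lemma exists_contact_relInradius (hK : IsSmoothStrictlyConvexBody K)
    (hL : IsSmoothStrictlyConvexBody L) (hKL : IsAtDilationPosition (K : Set Plane) L) (φ : ℝ) :
    ∃ z ∈ Set.Icc φ (φ + Real.pi),
      supportFn K z + -relInradius K L * supportFn L z = 0 := by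
  have hpi := Real.pi_pos
  set r := relInradius K L with hr
  have hr0 : 0 ≤ r := Real.sSup_nonneg fun t ht => ht.1.le
  have hcK := hK.contDiff_supportFn.continuous
  have hcL := hL.contDiff_supportFn.continuous
  by_contra! hno
  obtain ⟨x, ε, hε, hx⟩ := exists_sub_inner_pos
    (g := fun θ => supportFn K θ + -r * supportFn L θ) (by fun_prop)
    (fun θ => by simp only [supportFn_periodic _ θ]) (fun θ => by
      have := supportFn_mono K.isCompact L.nonempty.smul_set hKL.2.1 θ
      rw [supportFn_smul L.isCompact L.nonempty hr0] at this
      linarith) hno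
  obtain ⟨C, hC, hb⟩ := (supportFn_periodic (L : Set Plane)).exists_pos_forall_abs_le
    (by positivity) hcL
  have hpos := div_pos hε hC
  have hmem : r + ε / C ∈ {t : ℝ | 0 < t ∧ ∃ x : Plane, {x} + t • (L : Set Plane) ⊆ K} := by
    refine ⟨by linarith, x, subset_of_supportFn_le
      (isCompact_singleton.add (L.isCompact.smul _)) K.isCompact K.convex K.nonempty fun θ => ?_⟩
    rw [supportFn_singleton_add_smul L.isCompact L.nonempty x (by linarith)]
    have h1 := hx θ
    have h2 := mul_le_mul_of_nonneg_left ((le_abs_self _).trans (hb θ)) hpos.le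
    rw [div_mul_cancel₀ _ hC.ne'] at h2
    linarith
  have : r + ε / C ≤ r := le_csSup (bddAbove_relInradius K hL) hmem
  linarith

lemma relOutradius_pos (hK : IsSmoothStrictlyConvexBody K)
    (hKL : IsAtDilationPosition (K : Set Plane) L) : 0 < relOutradius K L := by
  refine lt_of_le_of_ne (Real.sInf_nonneg fun t ht => ht.1.le) fun h0 => ?_
  have h := hKL.2.2
  rw [← h0, Set.zero_smul_set L.nonempty] at h
  have hle : area K ≤ area (0 : Set Plane) :=
    measureReal_mono h (by simp [← Set.singleton_zero])
  have hz : area (0 : Set Plane) = 0 := by simp [area, ← Set.singleton_zero, measureReal_def]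
  linarith [hK.area_pos]

lemma exists_contact_relOutradius (hK : IsSmoothStrictlyConvexBody K)
    (hL : IsSmoothStrictlyConvexBody L) (hKL : IsAtDilationPosition (K : Set Plane) L) (φ : ℝ) :
    ∃ z ∈ Set.Icc φ (φ + Real.pi),
      supportFn K z + -relOutradius K L * supportFn L z = 0 := by
  have hpi := Real.pi_pos
  have hR0 := hK.relOutradius_pos hKL
  set R := relOutradius K L with hR
  have hcK := hK.contDiff_supportFn.continuous
  have hcL := hL.contDiff_supportFn.continuous
  by_contra! hno
  obtain ⟨x, ε, hε, hx⟩ := exists_sub_inner_pos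
    (g := fun θ => R * supportFn L θ - supportFn K θ) (by fun_prop)
    (fun θ => by simp only [supportFn_periodic _ θ]) (fun θ => by
      have := supportFn_mono (L.isCompact.smul R) K.nonempty hKL.2.2 θ
      rw [supportFn_smul L.isCompact L.nonempty hR0.le] at this
      linarith) (fun z hz h => hno z hz (by linarith))
  obtain ⟨C, hC, hb⟩ := (supportFn_periodic (L : Set Plane)).exists_pos_forall_abs_le
    (by positivity) hcL
  have hpos : 0 < min (ε / C) (R / 2) := lt_min (div_pos hε hC) (half_pos hR0)
  have hRle : min (ε / C) (R / 2) ≤ R / 2 := min_le_right _ _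
  have hmem : R - min (ε / C) (R / 2) ∈
      {t : ℝ | 0 < t ∧ ∃ x : Plane, (K : Set Plane) ⊆ {x} + t • (L : Set Plane)} := by
    refine ⟨by linarith, -x, subset_of_supportFn_le K.isCompact
      (isCompact_singleton.add (L.isCompact.smul _)) ((convex_singleton _).add (L.convex.smul _))
      ((Set.singleton_nonempty _).add L.nonempty.smul_set) fun θ => ?_⟩
    rw [supportFn_singleton_add_smul L.isCompact L.nonempty _ (by linarith), inner_neg_left]
    have h1 := hx θ
    have h2 := mul_le_mul_of_nonneg_left ((le_abs_self _).trans (hb θ)) hpos.le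
    have h3 := mul_le_mul_of_nonneg_right (min_le_left (ε / C) (R / 2)) hC.le
    rw [div_mul_cancel₀ _ hC.ne'] at h3
    linarith
  have : R ≤ R - min (ε / C) (R / 2) := csInf_le ⟨0, fun t ht => ht.1.le⟩ hmem
  linarith

/-- Bonnesen's inequality at a parameter `s` for which the zeros of `h_K - s h_L` meet every closed
half circle. -/
lemma bonnesen_of_contact (hK : IsSmoothStrictlyConvexBody K)
    (hL : IsSmoothStrictlyConvexBody L) {s : ℝ}
    (hs : ∀ φ, ∃ z ∈ Set.Icc φ (φ + Real.pi), supportFn K z + -s * supportFn L z = 0) :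
    area K - 2 * s * mixedArea K L + s ^ 2 * area L ≤ 0 := by
  have h := mixedForm_self_nonpos
    (hK.contDiff_one.add ((contDiff_const (c := -s)).mul hL.contDiff_one))
    (fun θ => by simp only [supportFn_periodic _ θ]) hs
  have h2 := mixedForm_add_mul_self hK.contDiff_one hL.contDiff_one (-s)
  rw [hK.mixedForm_self, hL.mixedForm_self, hK.mixedForm_eq_mixedArea hL] at h2
  have h3 := h2.symm.trans_le h
  linarith

end IsSmoothStrictlyConvexBody

/-! ### The weighted convexity inequality -/

lemma StrictConvexOn.continuous_comp_Ioi {F ρ : ℝ → ℝ} (hF : StrictConvexOn ℝ (Set.Ioi 0) F)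
    (hρ : Continuous ρ) (hpos : ∀ θ, 0 < ρ θ) : Continuous fun θ => F (ρ θ) :=
  (hF.convexOn.continuousOn isOpen_Ioi).comp_continuous hρ hpos

/-- If `b q ≤ p ≤ a q`, then `(a q - p) k` and `(p - b q) k` are weights of equal mass whose means
of `ρ` are exactly `a` and `b`. The supporting lines of `F` at `a` and at `b` give the inequality,
and it is strict because `ρ` would otherwise be constant. -/
lemma add_lt_integral_of_strictConvexOn {F p q k ρ : ℝ → ℝ} {A a b T : ℝ}
    (hF : StrictConvexOn ℝ (Set.Ioi 0) F) (hT : 0 < T)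
    (hp : Continuous p) (hq : Continuous q) (hk : Continuous k) (hρ : Continuous ρ)
    (hpT : Function.Periodic p T) (hqT : Function.Periodic q T) (hkT : Function.Periodic k T)
    (hρT : Function.Periodic ρ T)
    (hkpos : ∀ θ, 0 < k θ) (hρpos : ∀ θ, 0 < ρ θ)
    (hb : 0 < b) (hab : b < a) (hA : 0 < A)
    (hle : ∀ θ, p θ ≤ a * q θ) (hge : ∀ θ, b * q θ ≤ p θ)
    (hq0 : ∀ θ, ∃ᶠ φ in nhds θ, q φ ≠ 0)
    (h1 : ∫ θ in (0 : ℝ)..T, q θ * k θ = 2 * A)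
    (h2 : ∫ θ in (0 : ℝ)..T, p θ * k θ = A * (a + b))
    (h3 : ∫ θ in (0 : ℝ)..T, q θ * (ρ θ * k θ) = A * (a + b))
    (h4 : ∫ θ in (0 : ℝ)..T, p θ * (ρ θ * k θ) = 2 * (A * (a * b))) :
    A * (F a + F b) < ∫ θ in (0 : ℝ)..T, F (ρ θ) * q θ * k θ := by
  have ha : 0 < a := hb.trans hab
  have hFρ := hF.continuous_comp_Ioi hρ hρpos
  obtain ⟨m, hm⟩ := hF.exists_supportLine (p := a) (by rwa [interior_Ioi])
  obtain ⟨n, hn⟩ := hF.exists_supportLine (p := b) (by rwa [interior_Ioi])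
  obtain ⟨f, hf⟩ : ∃ f : ℝ → ℝ, ∀ θ, F (ρ θ) = f θ := ⟨_, fun _ => rfl⟩
  simp only [hf] at hFρ ⊢
  have hm0 : ∀ θ, 0 ≤ f θ - F a - m * (ρ θ - a) := fun θ => by
    by_cases h : ρ θ = a
    · simp [← hf, h]
    · rw [← hf]; exact (hm _ (hρpos θ) h).le
  have hn0 : ∀ θ, 0 ≤ f θ - F b - n * (ρ θ - b) := fun θ => by
    by_cases h : ρ θ = b
    · simp [← hf, h]
    · rw [← hf]; exact (hn _ (hρpos θ) h).le
  set G : ℝ → ℝ := fun θ => (a * q θ - p θ) * k θ * (f θ - F a - m * (ρ θ - a)) +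
    (p θ - b * q θ) * k θ * (f θ - F b - n * (ρ θ - b)) with hG
  have hGc : Continuous G := by simp only [hG]; fun_prop
  have hG1 : ∀ θ, 0 ≤ (a * q θ - p θ) * k θ * (f θ - F a - m * (ρ θ - a)) := fun θ =>
    mul_nonneg (mul_nonneg (sub_nonneg.2 (hle θ)) (hkpos θ).le) (hm0 θ)
  have hG2 : ∀ θ, 0 ≤ (p θ - b * q θ) * k θ * (f θ - F b - n * (ρ θ - b)) := fun θ =>
    mul_nonneg (mul_nonneg (sub_nonneg.2 (hge θ)) (hkpos θ).le) (hn0 θ)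
  have hGT : Function.Periodic G T := fun θ => by simp only [hG, ← hf, hpT θ, hqT θ, hkT θ, hρT θ]
  have hint : ∫ θ in (0 : ℝ)..T, G θ =
      (a - b) * ((∫ θ in (0 : ℝ)..T, f θ * q θ * k θ) - A * (F a + F b)) := by
    have hsplit : ∫ θ in (0 : ℝ)..T, G θ =
        (a - b) * (∫ θ in (0 : ℝ)..T, f θ * q θ * k θ)
        + (-(F a - m * a) * a + (F b - n * b) * b) * (∫ θ in (0 : ℝ)..T, q θ * k θ)
        + ((F a - m * a) - (F b - n * b)) * (∫ θ in (0 : ℝ)..T, p θ * k θ)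
        + (-(m * a) + n * b) * (∫ θ in (0 : ℝ)..T, q θ * (ρ θ * k θ))
        + (m - n) * (∫ θ in (0 : ℝ)..T, p θ * (ρ θ * k θ)) := by
      simp only [← intervalIntegral.integral_const_mul]
      rw [← intervalIntegral.integral_add, ← intervalIntegral.integral_add,
        ← intervalIntegral.integral_add, ← intervalIntegral.integral_add]
      · congr 1; ext θ; simp only [hG]; ring
      all_goals exact Continuous.intervalIntegrable (by fun_prop) _ _
    rw [hsplit, h1, h2, h3, h4]
    ring
  suffices hpos : 0 < ∫ θ in (0 : ℝ)..T, G θ by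
    rw [hint] at hpos
    exact sub_pos.1 (pos_of_mul_pos_right hpos (sub_nonneg.2 hab.le))
  by_contra hnpos
  have hG0 : ∀ θ, G θ = 0 := by
    intro θ
    by_contra hne
    obtain ⟨φ, hφ, he⟩ := hGT.exists_mem_Ico₀ hT θ
    rw [he] at hne
    exact hnpos (intervalIntegral.integral_pos hT hGc.continuousOn
      (fun x _ => add_nonneg (hG1 x) (hG2 x)) ⟨φ, ⟨hφ.1, hφ.2.le⟩,
        lt_of_le_of_ne (add_nonneg (hG1 φ) (hG2 φ)) (Ne.symm hne)⟩)
  -- Where `ρ` is neither `a` nor `b` both weights vanish, hence so does their sum `(a - b) q k`.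
  have hdich : ∀ θ, ρ θ = a ∨ ρ θ = b := by
    intro θ
    by_contra! hne
    have hev : ∀ᶠ φ in nhds θ, ρ φ ≠ a ∧ ρ φ ≠ b :=
      (hρ.continuousAt.eventually_ne hne.1).and (hρ.continuousAt.eventually_ne hne.2)
    obtain ⟨φ, hqφ, hφa, hφb⟩ := ((hq0 θ).and_eventually hev).exists
    have hz := (add_eq_zero_iff_of_nonneg (hG1 φ) (hG2 φ)).1 (hG0 φ)
    have e1 := (mul_eq_zero.1 ((mul_eq_zero.1 hz.1).resolve_right
      (hf φ ▸ hm _ (hρpos φ) hφa).ne')).resolve_right (hkpos φ).ne'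
    have e2 := (mul_eq_zero.1 ((mul_eq_zero.1 hz.2).resolve_right
      (hf φ ▸ hn _ (hρpos φ) hφb).ne')).resolve_right (hkpos φ).ne'
    have e3 : (a - b) * q φ = 0 := by linear_combination e1 + e2
    exact hqφ ((mul_eq_zero.1 e3).resolve_left (sub_pos.2 hab).ne')
  have hconst : ∀ c, (∀ θ, ρ θ = c) → 2 * c = a + b := by
    intro c hc
    simp only [hc] at h3
    have : ∫ θ in (0 : ℝ)..T, q θ * (c * k θ) = c * (2 * A) := by
      rw [← h1, ← intervalIntegral.integral_const_mul]
      congr 1; ext θ; ring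
    rw [this] at h3
    exact mul_left_cancel₀ hA.ne' (by linear_combination h3)
  by_cases hall : ∀ θ, ρ θ = a
  · linarith [hconst a hall]
  by_cases hall' : ∀ θ, ρ θ = b
  · linarith [hconst b hall']
  push Not at hall hall'
  obtain ⟨x, hx⟩ := hall
  obtain ⟨y, hy⟩ := hall'
  have hxb := (hdich x).resolve_left hx
  have hya := (hdich y).resolve_right hy
  obtain ⟨z, hz⟩ := mem_range_of_exists_le_of_exists_ge hρ (c := (a + b) / 2)
    ⟨x, by linarith⟩ ⟨y, by linarith⟩
  rcases hdich z with h | h <;> linarith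

/-- The roots of a quadratic with positive leading and constant coefficients, up to sign, when
`C - 2 B t + A t²` is nonpositive at `r ≥ 0` and at `R`. -/
lemma exists_roots_of_nonpos {A B C r R : ℝ} (hA : 0 < A) (hC : 0 < C) (hr0 : 0 ≤ r)
    (hr : C - 2 * r * B + r ^ 2 * A ≤ 0) (hR : C - 2 * R * B + R ^ 2 * A ≤ 0) :
    ∃ a b : ℝ, 0 < b ∧ b ≤ a ∧ 2 * B = A * (a + b) ∧ C = A * (a * b) ∧
      (b ≤ r ∧ r ≤ a) ∧ (b ≤ R ∧ R ≤ a) := by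
  have hD : 0 ≤ B ^ 2 - A * C := by nlinarith [sq_nonneg (r * A - B)]
  have hB : 0 < B := by
    by_contra! h
    nlinarith [mul_nonneg hr0 (neg_nonneg.2 h), mul_nonneg (sq_nonneg r) hA.le]
  set d := Real.sqrt (B ^ 2 - A * C) with hd
  have hd2 : d ^ 2 = B ^ 2 - A * C := Real.sq_sqrt hD
  have hd0 : 0 ≤ d := Real.sqrt_nonneg _
  have hdB : d < B := by nlinarith [mul_pos hA hC]
  have hbound : ∀ t, C - 2 * t * B + t ^ 2 * A ≤ 0 → (B - d) / A ≤ t ∧ t ≤ (B + d) / A := by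
    intro t ht
    have h1 : (t * A - B) ^ 2 ≤ d ^ 2 := by rw [hd2]; nlinarith
    have h2 := abs_le_of_sq_le_sq' h1 hd0
    rw [div_le_iff₀ hA, le_div_iff₀ hA]
    constructor <;> linarith [h2.1, h2.2]
  refine ⟨(B + d) / A, (B - d) / A, div_pos (by linarith) hA,
    div_le_div_of_nonneg_right (by linarith) hA.le, ?_, ?_, hbound r hr, hbound R hR⟩
  · field_simp; ring
  · field_simp; linear_combination hd2

lemma roots_steinerPoly {K L : Set Plane} {a b : ℝ} (hA : 0 < area L)
    (h1 : 2 * mixedArea K L = area L * (a + b)) (h2 : area K = area L * (a * b)) :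
    (steinerPoly K L).roots = {-a, -b} := by
  have hfac : steinerPoly K L = Polynomial.C (area L) *
      ((Polynomial.X - Polynomial.C (-a)) * (Polynomial.X - Polynomial.C (-b))) := by
    rw [steinerPoly, h1, h2]
    simp only [map_mul, map_add, map_neg]
    ring
  rw [hfac, Polynomial.roots_C_mul _ hA.ne', Polynomial.roots_mul
    (mul_ne_zero (Polynomial.X_sub_C_ne_zero _) (Polynomial.X_sub_C_ne_zero _)),
    Polynomial.roots_X_sub_C, Polynomial.roots_X_sub_C]
  rfl

/-! ### The Green–Osher inequality at a dilation position -/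

namespace IsSmoothStrictlyConvexBody

variable {K L : ConvexBody Plane}

/-- The support function vanishes on no open interval, since `h + h''` is positive. -/
lemma frequently_supportFn_ne_zero (hL : IsSmoothStrictlyConvexBody L) (θ : ℝ) :
    ∃ᶠ φ in nhds θ, supportFn (L : Set Plane) φ ≠ 0 := by
  intro h
  simp only [not_not] at h
  have h0 : supportFn (L : Set Plane) =ᶠ[nhds θ] fun _ => 0 := h
  have h2 : deriv (deriv (supportFn (L : Set Plane))) θ = 0 := by
    rw [h0.deriv.deriv_eq]
    simp
  have := hL.curvRadius_pos θ
  rw [curvRadius, h0.eq_of_nhds, h2] at this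
  simp at this

lemma relCurvRadius_mul (hL : IsSmoothStrictlyConvexBody L) (θ : ℝ) :
    relCurvRadius K L θ * curvRadius L θ = curvRadius K θ :=
  div_mul_cancel₀ _ (hL.curvRadius_pos θ).ne'

lemma continuous_relCurvRadius (hK : IsSmoothStrictlyConvexBody K)
    (hL : IsSmoothStrictlyConvexBody L) : Continuous (relCurvRadius (K : Set Plane) L) :=
  (continuous_curvRadius hK.contDiff_supportFn).div (continuous_curvRadius hL.contDiff_supportFn)
    fun θ => (hL.curvRadius_pos θ).ne'

lemma relCurvRadius_pos (hK : IsSmoothStrictlyConvexBody K)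
    (hL : IsSmoothStrictlyConvexBody L) (θ : ℝ) : 0 < relCurvRadius (K : Set Plane) L θ :=
  div_pos (hK.curvRadius_pos θ) (hL.curvRadius_pos θ)

lemma curvRadius_singleton_add_smul (hL : IsSmoothStrictlyConvexBody L) (x : Plane)
    {c : ℝ} (hc : 0 ≤ c) (θ : ℝ) :
    curvRadius ({x} + c • (L : Set Plane)) θ = c * curvRadius L θ := by
  have hs : supportFn ({x} + c • (L : Set Plane)) =
      fun θ => (x 0 * Real.cos θ + x 1 * Real.sin θ) + c * supportFn L θ := funext fun θ => by
    rw [supportFn_singleton_add_smul L.isCompact L.nonempty x hc, inner_unitDir]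
  have hd1 : deriv (fun θ : ℝ => x 0 * Real.cos θ + x 1 * Real.sin θ) =
      fun θ => -(x 0) * Real.sin θ + x 1 * Real.cos θ := funext fun θ =>
    ((((Real.hasDerivAt_cos θ).const_mul (x 0)).add
      ((Real.hasDerivAt_sin θ).const_mul (x 1))).congr_deriv (by ring)).deriv
  have hd2 : deriv (fun θ : ℝ => -(x 0) * Real.sin θ + x 1 * Real.cos θ) θ =
      -(x 0 * Real.cos θ + x 1 * Real.sin θ) :=
    ((((Real.hasDerivAt_sin θ).const_mul (-(x 0))).add
      ((Real.hasDerivAt_cos θ).const_mul (x 1))).congr_deriv (by ring)).deriv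
  rw [curvRadius, hs, deriv_deriv_add_mul (by fun_prop) hL.contDiff_supportFn, hd1, hd2, curvRadius]
  ring

/-- For homothetic bodies `K = x + c L` the relative curvature radius is constant, and the relative
Steiner polynomial has the double root `-c`. -/
lemma of_areHomothetic (hK : IsSmoothStrictlyConvexBody K) (hL : IsSmoothStrictlyConvexBody L)
    (h : AreHomothetic (K : Set Plane) L) : ∃ c : ℝ, (∀ θ, relCurvRadius (K : Set Plane) L θ = c) ∧
      2 * mixedArea K L = area L * (2 * c) ∧ area K = area L * c ^ 2 := by
  obtain ⟨x, c, hc, he⟩ := h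
  have hcurv : ∀ θ, curvRadius K θ = c * curvRadius L θ := fun θ => by
    rw [he]; exact hL.curvRadius_singleton_add_smul x hc.le θ
  refine ⟨c, fun θ => by rw [relCurvRadius, hcurv, mul_div_cancel_right₀ _
    (hL.curvRadius_pos θ).ne'], ?_, ?_⟩
  · rw [← hK.integral_supportFn_mul_curvRadius' hL]
    simp only [hcurv, mul_left_comm _ c]
    rw [intervalIntegral.integral_const_mul, hL.integral_supportFn_mul_curvRadius_self]
    ring
  · rw [he, area_singleton_add_smul]
    ring

end IsSmoothStrictlyConvexBody

end

theorem theorem1p1 (K L : ConvexBody Plane)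
    (hK : IsSmoothStrictlyConvexBody K) (hL : IsSmoothStrictlyConvexBody L)
    (hKL : IsAtDilationPosition K L)
    (F : ℝ → ℝ) (hF : StrictConvexOn ℝ (Set.Ioi 0) F) :
    -- the area of `K + tL` is given by the relative Steiner polynomial
    (∀ t : ℝ, 0 ≤ t →
      area ((K : Set Plane) + t • (L : Set Plane)) = (steinerPoly K L).eval t) ∧
    -- the integral in the inequality exists
    IntervalIntegrable
      (fun θ => F (relCurvRadius K L θ) * supportFn L θ * curvRadius L θ)
      volume 0 (2 * Real.pi) ∧
    -- the relative Steiner polynomial has two negative real roots, counted with multiplicity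
    ∃ t₁ t₂ : ℝ, (steinerPoly K L).roots = {t₁, t₂} ∧ t₁ < 0 ∧ t₂ < 0 ∧
      (F (-t₁) + F (-t₂) ≤
        1 / area L * (∫ θ in (0 : ℝ)..(2 * Real.pi),
          F (relCurvRadius K L θ) * supportFn L θ * curvRadius L θ)) ∧
      (1 / area L * (∫ θ in (0 : ℝ)..(2 * Real.pi),
          F (relCurvRadius K L θ) * supportFn L θ * curvRadius L θ) =
        F (-t₁) + F (-t₂) ↔ AreHomothetic (K : Set Plane) (L : Set Plane)) := by
  have hA := hL.area_pos
  have hcK := hK.contDiff_supportFn.continuous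
  have hcL := hL.contDiff_supportFn.continuous
  have hkL := continuous_curvRadius hL.contDiff_supportFn
  have hρ := hK.continuous_relCurvRadius hL
  have hρpos := hK.relCurvRadius_pos hL
  have hFρ := hF.continuous_comp_Ioi hρ hρpos
  have hr0 : 0 ≤ relInradius K L := Real.sSup_nonneg fun t ht => ht.1.le
  have hR0 := hK.relOutradius_pos hKL
  refine ⟨fun t ht => hK.eval_steinerPoly hL ht,
    ((hFρ.mul hcL).mul hkL).intervalIntegrable _ _, ?_⟩
  obtain ⟨a, b, hb, hba, hsum, hprod, ⟨hbr, hra⟩, hbR, hRa⟩ := exists_roots_of_nonpos hA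
    hK.area_pos hr0 (hK.bonnesen_of_contact hL (hK.exists_contact_relInradius hL hKL))
    (hK.bonnesen_of_contact hL (hK.exists_contact_relOutradius hL hKL))
  have hnnL := supportFn_nonneg L.isCompact hL.zero_mem
  -- In a dilation position the bounds `b ≤ r` and `R ≤ a` hold for support functions, pointwise.
  have hge : ∀ θ, b * supportFn L θ ≤ supportFn K θ := fun θ => by
    have h := supportFn_mono K.isCompact L.nonempty.smul_set hKL.2.1 θ
    rw [supportFn_smul L.isCompact L.nonempty hr0] at h
    exact (mul_le_mul_of_nonneg_right hbr (hnnL θ)).trans h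
  have hle : ∀ θ, supportFn K θ ≤ a * supportFn L θ := fun θ => by
    have h := supportFn_mono (L.isCompact.smul _) K.nonempty hKL.2.2 θ
    rw [supportFn_smul L.isCompact L.nonempty hR0.le] at h
    exact h.trans (mul_le_mul_of_nonneg_right hRa (hnnL θ))
  have heq : AreHomothetic (K : Set Plane) L →
      1 / area L * (∫ θ in (0 : ℝ)..(2 * Real.pi),
        F (relCurvRadius K L θ) * supportFn L θ * curvRadius L θ) = F a + F b := by
    intro h
    obtain ⟨c, hc, hB, hC⟩ := hK.of_areHomothetic hL h
    have e1 : a + b = 2 * c := mul_left_cancel₀ hA.ne' (hsum.symm.trans hB)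
    have e2 : a * b = c ^ 2 := mul_left_cancel₀ hA.ne' (hprod.symm.trans hC)
    have hac : a = c := by
      have : (a - c) ^ 2 = 0 := by linear_combination a * e1 - e2
      exact sub_eq_zero.1 (pow_eq_zero_iff two_ne_zero |>.1 this)
    have hbc : b = c := by linarith
    simp only [hc, hac, hbc, mul_assoc]
    rw [intervalIntegral.integral_const_mul, hL.integral_supportFn_mul_curvRadius_self]
    field_simp
    ring
  refine ⟨-a, -b, roots_steinerPoly hA hsum hprod, by linarith, by linarith, ?_⟩
  rw [neg_neg, neg_neg]
  rcases hba.eq_or_lt with hab | hab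
  · have hhom : AreHomothetic (K : Set Plane) L := by
      refine ⟨0, a, hb.trans_le hba, ?_⟩
      rw [Set.singleton_zero, zero_add]
      have hr : relInradius K L = a := le_antisymm hra (hab ▸ hbr)
      have hR : relOutradius K L = a := le_antisymm hRa (hab ▸ hbR)
      refine Set.Subset.antisymm ?_ ?_
      · rw [← hR]; exact hKL.2.2
      · rw [← hr]; exact hKL.2.1
    exact ⟨(heq hhom).ge, fun _ => hhom, heq⟩
  · have hstrict := add_lt_integral_of_strictConvexOn hF Real.two_pi_pos hcK hcL hkL hρ
      (supportFn_periodic _) (supportFn_periodic _) (curvRadius_periodic _)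
      (fun θ => by simp only [relCurvRadius, curvRadius_periodic _ θ])
      hL.curvRadius_pos hρpos hb hab hA hle hge hL.frequently_supportFn_ne_zero
      hL.integral_supportFn_mul_curvRadius_self
      ((hK.integral_supportFn_mul_curvRadius hL).trans hsum)
      (by simp only [hL.relCurvRadius_mul]
          exact (hK.integral_supportFn_mul_curvRadius' hL).trans hsum)
      (by simp only [hL.relCurvRadius_mul]
          rw [hK.integral_supportFn_mul_curvRadius_self, hprod])
    have hlt : F a + F b < 1 / area L * (∫ θ in (0 : ℝ)..(2 * Real.pi),
        F (relCurvRadius K L θ) * supportFn L θ * curvRadius L θ) := by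
      rw [one_div, ← div_eq_inv_mul, lt_div_iff₀ hA]
      linarith
    exact ⟨hlt.le, fun h => absurd h hlt.ne', heq⟩
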